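/- Let $?:[0,1]\to[0,1]$ be the Minkowski question mark function, $$?([0,a_1,a_2,a_3,\ldots])=2^{1-a_1}-2^{1-(a_1+a_2)}+2^{1-(a_1+a_2+a_3)}-\cdots,$$ where $x=[0,a_1,a_2,\ldots]=\cfrac{1}{a_1+\cfrac{1}{a_2+\cdots}}$ is the regular continued fraction of $x$ (for rational $x$ the sum is finite, and $?(0)=0$). It is non-decreasing, and $\mathrm{d}?(x)$ denotes its Lebesgue–Stieltjes measure. Let $$I_1(x)=\sum_{k=0}^{\infty}\frac{(x/2)^{2k+1}}{k!\,(k+1)!}$$ be the modified Bessel function of the first kind of order $1$. For integers $L\ge1$ and $\ell\ge0$ put $$T_{L,\ell}=\int\limits_{[0,\infty)^{\ell+1}}x_0^{L}\cdot\frac{(x_0x_\ell)^{-1/2}\cdot\prod_{i=0}^{\ell-1}I_1(2\sqrt{x_ix_{i+1}})}{\prod_{i=0}^{\ell}e^{x_i}(2e^{x_i}-1)}\,\mathrm{d}x_0\cdots\mathrm{d}x_\ell ,$$ where an empty product equals $1$. **Theorem.** For every integer $L\ge1$ all the integrals $T_{L,\ell}$, $\ell\ge0$, converge absolutely, the series $\sum_{\ell\ge0}T_{L,\ell}$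 converges, and $$\int_0^1x^L\,\mathrm{d}?(x)=\frac{1}{(L-1)!}\sum_{\ell=0}^{\infty}T_{L,\ell}.$$ Moreover, there is an absolute constant $C$ such that $\frac{1}{(L-1)!}\,|T_{L,\ell}|\le C\,2^{-\ell}$ for all $L\ge1$ and $\ell\ge0$. -/

import Mathlib

open MeasureTheory

noncomputable section

namespace QuestionMark

/-- The `(n+1)`-st partial quotient of the regular continued fraction
`x = [⌊x⌋, a₁, a₂, …]`, or `none` if the expansion has terminated before it. -/
def digit (x : ℝ) (n : ℕ) : Option ℝ := (GenContFract.of x).partDens.get? n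

/-- The `n`-th term `(-1)^n 2^{1 - (a₁ + ⋯ + a_{n+1})}` of the series of `?(x)`;
it is `0` if the expansion of `x` has fewer than `n + 1` partial quotients. -/
def term (x : ℝ) (n : ℕ) : ℝ :=
  match digit x n with
  | none => 0
  | some _ => (-1) ^ n * (2 : ℝ) ^ (1 - ∑ i ∈ Finset.range (n + 1), (digit x i).getD 0)

/-- The Minkowski question mark function, extended from `[0, 1]` to `ℝ` by `?(x + 1) = ?(x) + 1`.
For `x ∈ [0, 1)` it is `2^{1-a₁} - 2^{1-(a₁+a₂)} + ⋯` with `x = [0, a₁, a₂, …]`, and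
`?(1) = 1`, which is also the value that `1 = [0, 1]` gives. -/
def questionMark (x : ℝ) : ℝ := ⌊x⌋ + ∑' n, term x n

theorem digit_zero_of_fract_ne {x : ℝ} (h : Int.fract x ≠ 0) :
    digit x 0 = some (⌊(Int.fract x)⁻¹⌋ : ℝ) := by
  have := GenContFract.of_s_head h
  rw [Stream'.Seq.head] at this
  simp [digit, GenContFract.partDens, Stream'.Seq.map_get?, this]

theorem digit_succ (x : ℝ) (n : ℕ) : digit x (n + 1) = digit (Int.fract x)⁻¹ n := by
  simp [digit, GenContFract.partDens, Stream'.Seq.map_get?, GenContFract.of_s_succ]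

theorem digit_of_fract_eq {x : ℝ} (h : Int.fract x = 0) (n : ℕ) : digit x n = none := by
  have hx : x = ((⌊x⌋ : ℤ) : ℝ) := by
    have := Int.floor_add_fract x
    linarith
  rw [hx]
  simp only [digit, GenContFract.partDens, Stream'.Seq.map_get?, GenContFract.of_s_of_int]
  rfl

theorem one_le_floor_inv {x : ℝ} (h : Int.fract x ≠ 0) : 1 ≤ ⌊(Int.fract x)⁻¹⌋ := by
  have h0 : 0 < Int.fract x := lt_of_le_of_ne (Int.fract_nonneg x) (Ne.symm h)
  rw [Int.le_floor]
  push_cast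
  exact (one_le_inv₀ h0).2 (Int.fract_lt_one x).le

theorem term_of_fract_eq {x : ℝ} (h : Int.fract x = 0) (n : ℕ) : term x n = 0 := by
  simp [term, digit_of_fract_eq h]

theorem term_zero_of_fract_ne {x : ℝ} (h : Int.fract x ≠ 0) :
    term x 0 = 2 * (2 : ℝ) ^ (-(⌊(Int.fract x)⁻¹⌋ : ℝ)) := by
  simp only [term, digit_zero_of_fract_ne h, zero_add, Finset.sum_range_one, Option.getD_some,
    pow_zero, one_mul]
  rw [sub_eq_add_neg, Real.rpow_add two_pos, Real.rpow_one]

theorem term_succ_of_fract_ne {x : ℝ} (h : Int.fract x ≠ 0) (n : ℕ) :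
    term x (n + 1) =
      -(2 : ℝ) ^ (-(⌊(Int.fract x)⁻¹⌋ : ℝ)) * term (Int.fract x)⁻¹ n := by
  simp only [term, digit_succ x n]
  cases digit (Int.fract x)⁻¹ n with
  | none => simp
  | some a =>
    simp only
    rw [Finset.sum_range_succ', digit_zero_of_fract_ne h]
    simp only [digit_succ, Option.getD_some]
    rw [show (1 : ℝ) - (∑ i ∈ Finset.range (n + 1), (digit (Int.fract x)⁻¹ i).getD 0 +
        (⌊(Int.fract x)⁻¹⌋ : ℝ)) = -(⌊(Int.fract x)⁻¹⌋ : ℝ) +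
        (1 - ∑ i ∈ Finset.range (n + 1), (digit (Int.fract x)⁻¹ i).getD 0) by ring,
      Real.rpow_add two_pos]
    ring

theorem two_rpow_neg_le_half {a : ℤ} (h : 1 ≤ a) : (2 : ℝ) ^ (-(a : ℝ)) ≤ 1 / 2 := by
  have h' : (1 : ℝ) ≤ a := by exact_mod_cast h
  calc (2 : ℝ) ^ (-(a : ℝ)) ≤ (2 : ℝ) ^ (-1 : ℝ) :=
        Real.rpow_le_rpow_of_exponent_le one_le_two (by linarith)
    _ = 1 / 2 := by rw [Real.rpow_neg_one]; norm_num

theorem abs_term_le (n : ℕ) : ∀ x : ℝ, |term x n| ≤ (1 / 2 : ℝ) ^ n := by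
  induction n with
  | zero =>
    intro x
    by_cases h : Int.fract x = 0
    · simp [term_of_fract_eq h]
    · have h1 := two_rpow_neg_le_half (one_le_floor_inv h)
      have h2 := Real.rpow_pos_of_pos two_pos (-(⌊(Int.fract x)⁻¹⌋ : ℝ))
      rw [term_zero_of_fract_ne h, abs_of_pos (by positivity), pow_zero]
      linarith
  | succ n ih =>
    intro x
    by_cases h : Int.fract x = 0
    · rw [term_of_fract_eq h, abs_zero]
      positivity
    · have h1 := two_rpow_neg_le_half (one_le_floor_inv h)
      have h2 := Real.rpow_pos_of_pos two_pos (-(⌊(Int.fract x)⁻¹⌋ : ℝ))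
      rw [term_succ_of_fract_ne h, abs_mul, abs_neg, abs_of_pos h2, pow_succ']
      exact mul_le_mul h1 (ih _) (abs_nonneg _) (by norm_num)

theorem summable_term (x : ℝ) : Summable (term x) :=
  Summable.of_norm_bounded summable_geometric_two fun n => abs_term_le n x

theorem tsum_term_of_fract_eq {x : ℝ} (h : Int.fract x = 0) : ∑' n, term x n = 0 := by
  simp [term_of_fract_eq h]

theorem tsum_term_of_fract_ne {x : ℝ} (h : Int.fract x ≠ 0) :
    ∑' n, term x n =
      (2 : ℝ) ^ (-(⌊(Int.fract x)⁻¹⌋ : ℝ)) * (2 - ∑' n, term (Int.fract x)⁻¹ n) := by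
  rw [(summable_term x).tsum_eq_zero_add, term_zero_of_fract_ne h]
  simp only [term_succ_of_fract_ne h]
  rw [tsum_mul_left]
  ring

theorem tsum_term_bounds_aux (k : ℕ) : ∀ x : ℝ,
    -(2 * (1 / 2 : ℝ) ^ k) ≤ ∑' n, term x n ∧
      ∑' n, term x n ≤ 1 + 2 * (1 / 2 : ℝ) ^ k := by
  induction k with
  | zero =>
    intro x
    have h : ‖∑' n, term x n‖ ≤ 2 :=
      tsum_of_norm_bounded hasSum_geometric_two fun n => abs_term_le n x
    rw [Real.norm_eq_abs] at h
    rw [abs_le] at h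
    constructor <;> linarith [h.1, h.2]
  | succ k ih =>
    intro x
    have he : (0 : ℝ) < (1 / 2 : ℝ) ^ k := by positivity
    rw [pow_succ]
    by_cases h : Int.fract x = 0
    · rw [tsum_term_of_fract_eq h]
      constructor <;> linarith
    · have h1 := two_rpow_neg_le_half (one_le_floor_inv h)
      have h2 := Real.rpow_pos_of_pos two_pos (-(⌊(Int.fract x)⁻¹⌋ : ℝ))
      obtain ⟨hl, hu⟩ := ih (Int.fract x)⁻¹
      rw [tsum_term_of_fract_ne h]
      constructor <;> nlinarith

theorem tsum_term_mem (x : ℝ) : 0 ≤ ∑' n, term x n ∧ ∑' n, term x n ≤ 1 := by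
  have hlim : Filter.Tendsto (fun k : ℕ => 2 * (1 / 2 : ℝ) ^ k) Filter.atTop (nhds 0) := by
    simpa using (tendsto_pow_atTop_nhds_zero_of_lt_one (r := (1 / 2 : ℝ))
      (by norm_num) (by norm_num)).const_mul 2
  constructor
  · have h : Filter.Tendsto (fun k : ℕ => -(2 * (1 / 2 : ℝ) ^ k)) Filter.atTop (nhds 0) := by
      simpa using hlim.neg
    exact le_of_tendsto h (Filter.Eventually.of_forall fun k => (tsum_term_bounds_aux k x).1)
  · have h : Filter.Tendsto (fun k : ℕ => 1 + 2 * (1 / 2 : ℝ) ^ k) Filter.atTop (nhds 1) := by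
      simpa using hlim.const_add 1
    exact ge_of_tendsto h (Filter.Eventually.of_forall fun k => (tsum_term_bounds_aux k x).2)

theorem questionMark_sub_le (k : ℕ) : ∀ x y : ℝ, x ≤ y →
    questionMark x - questionMark y ≤ (1 / 2 : ℝ) ^ k := by
  have hfloor : ∀ x y : ℝ, ⌊x⌋ < ⌊y⌋ → questionMark x - questionMark y ≤ 0 := by
    intro x y h
    have h' : (⌊x⌋ : ℝ) + 1 ≤ ⌊y⌋ := by exact_mod_cast h
    have := tsum_term_mem x
    have := tsum_term_mem y
    unfold questionMark
    linarith
  induction k with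
  | zero =>
    intro x y hxy
    rcases (Int.floor_le_floor hxy).lt_or_eq with h | h
    · linarith [hfloor x y h]
    · have := tsum_term_mem x
      have := tsum_term_mem y
      unfold questionMark
      rw [h]
      norm_num
      linarith
  | succ k ih =>
    intro x y hxy
    have he : (0 : ℝ) < (1 / 2 : ℝ) ^ (k + 1) := by positivity
    rcases (Int.floor_le_floor hxy).lt_or_eq with h | h
    · linarith [hfloor x y h]
    have hd : questionMark x - questionMark y = ∑' n, term x n - ∑' n, term y n := by
      unfold questionMark
      rw [h]
      ring
    rw [hd]
    by_cases hx : Int.fract x = 0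
    · rw [tsum_term_of_fract_eq hx]
      linarith [tsum_term_mem y]
    have hx0 : 0 < Int.fract x := lt_of_le_of_ne (Int.fract_nonneg x) (Ne.symm hx)
    have hfr : Int.fract x ≤ Int.fract y := by
      have h' : (⌊x⌋ : ℝ) = ⌊y⌋ := by exact_mod_cast h
      unfold Int.fract
      linarith
    have hy : Int.fract y ≠ 0 := (hx0.trans_le hfr).ne'
    have hinv : (Int.fract y)⁻¹ ≤ (Int.fract x)⁻¹ := inv_anti₀ hx0 hfr
    rw [tsum_term_of_fract_ne hx, tsum_term_of_fract_ne hy]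
    have hbx := tsum_term_mem (Int.fract x)⁻¹
    have hby := tsum_term_mem (Int.fract y)⁻¹
    have hpx := Real.rpow_pos_of_pos two_pos (-(⌊(Int.fract x)⁻¹⌋ : ℝ))
    have hpy := Real.rpow_pos_of_pos two_pos (-(⌊(Int.fract y)⁻¹⌋ : ℝ))
    rcases (Int.floor_le_floor hinv).lt_or_eq with hlt | heq
    · have h1 : 2 * (2 : ℝ) ^ (-(⌊(Int.fract x)⁻¹⌋ : ℝ)) ≤
          (2 : ℝ) ^ (-(⌊(Int.fract y)⁻¹⌋ : ℝ)) := by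
        have h' : (⌊(Int.fract y)⁻¹⌋ : ℝ) + 1 ≤ ⌊(Int.fract x)⁻¹⌋ := by exact_mod_cast hlt
        calc 2 * (2 : ℝ) ^ (-(⌊(Int.fract x)⁻¹⌋ : ℝ))
            = (2 : ℝ) ^ (1 + -(⌊(Int.fract x)⁻¹⌋ : ℝ)) := by
              rw [Real.rpow_add two_pos, Real.rpow_one]
          _ ≤ _ := Real.rpow_le_rpow_of_exponent_le one_le_two (by linarith)
      nlinarith
    · have h1 := two_rpow_neg_le_half (one_le_floor_inv hx)
      have hk := ih _ _ hinv
      unfold questionMark at hk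
      rw [heq] at hk ⊢
      rw [pow_succ]
      have he' : (0 : ℝ) < (1 / 2 : ℝ) ^ k := by positivity
      nlinarith

theorem monotone_questionMark : Monotone questionMark := by
  intro x y hxy
  have h := ge_of_tendsto (tendsto_pow_atTop_nhds_zero_of_lt_one (r := (1 / 2 : ℝ))
    (by norm_num) (by norm_num))
    (Filter.Eventually.of_forall fun k => questionMark_sub_le k x y hxy)
  linarith

/-- The Lebesgue–Stieltjes measure `d?(x)` of the monotone function `?`. -/
def dQuestionMark : Measure ℝ := monotone_questionMark.stieltjesFunction.measure

/-- The moment `m_L = ∫_0^1 x^L d?(x)`. -/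
def moment (L : ℕ) : ℝ := ∫ x in Set.Icc (0 : ℝ) 1, x ^ L ∂dQuestionMark

/-- The modified Bessel function `I₁(x) = ∑_k (x/2)^{2k+1} / (k! (k+1)!)`. -/
def besselI₁ (x : ℝ) : ℝ :=
  ∑' k : ℕ, (x / 2) ^ (2 * k + 1) / ((k.factorial : ℝ) * ((k + 1).factorial : ℝ))

/-- The integrand of the `ℓ`-th term, in the variables `x 0, …, x ℓ`. -/
def integrand (L ℓ : ℕ) (x : Fin (ℓ + 1) → ℝ) : ℝ :=
  x 0 ^ L *
    (((x 0 * x (Fin.last ℓ)) ^ (-(1 / 2) : ℝ) *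
        ∏ i : Fin ℓ, besselI₁ (2 * √(x i.castSucc * x i.succ))) /
      ∏ i : Fin (ℓ + 1), (Real.exp (x i) * (2 * Real.exp (x i) - 1)))

/-- The region `[0, ∞)^{ℓ+1}`. -/
def orthant (ℓ : ℕ) : Set (Fin (ℓ + 1) → ℝ) := {x | ∀ i, 0 ≤ x i}

/-- The `(ℓ+1)`-fold integral in the `ℓ`-th term, over `[0, ∞)^{ℓ+1}`. -/
def multiIntegral (L ℓ : ℕ) : ℝ := ∫ x in orthant ℓ, integrand L ℓ x

end QuestionMark

end

/-!
The measure `d?` is the law of a random continued fraction. Since `?` satisfies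
`?(1 / (j + 2 - c)) = 2^{-(j+1)} (1 + ?(c))` on `[0, 1]` (`questionMark_branch`) and is continuous,
`d?` is the law of `X = 1 / (A₁ - 1 / (A₂ - ⋯))` with independent digits `A = j + 2` of probability
`2^{-(j+1)}`. In other words, `d?` is invariant under the averaging operator
`U f(c) = ∑ 2^{-(j+1)} f(1 / (j + 2 - c))` (`integral_transfer`).

On the other side, expanding the weight `1 / (eˢ(2eˢ - 1)) = ∑ 2^{-(j+1)} e^{-(j+2)s}` and the
Bessel function, the integral operator with kernel `√(t / s) I₁(2√(ts))` and this weight maps the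
exponential `e^{cs}` to `U(e^{t·})(c) - 1` (`lintegral_kernel_add_one`). Integrating out one
variable after the other gives
`T_{L,ℓ} / (L - 1)! = (U^{ℓ+1} f)(0) - (U^ℓ f)(0)` with `f(x) = x^L` (`chain_add_transferPow`,
`multiIntegral_eq`). All integrands are nonnegative, so this is done with Tonelli's theorem in
`[0, ∞]`, and integrability follows from the finiteness of the result. The series telescopes, and
what is left is to show that `(U^ℓ f)(0)` tends to `𝔼 X^L` with increments at most `2^{-ℓ}`.

The branch `1 / (2 - c)` has the neutral fixed point `1`, so a Lipschitz estimate is not contracted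
by the factor `1 / 2`. The weighted estimate `f(y) - f(x) ≤ κ (y - x) / (1 - y)` is
(`IncrementBound.transfer`), and `x^L` satisfies it with `κ = 1` for every `L`. Hence
`0 ≤ (U^ℓ f)(x) - (U^ℓ f)(0) ≤ 2^{-ℓ} x / (1 - x)`. At `x = 1 / (j + 2)` this bounds the increments,
with `C = 1`. Integrated against `d?`, which has no atom at `1`, it gives the limit by dominated
convergence, as `𝔼 (U^ℓ f)(X) = 𝔼 f(X)`.
-/

namespace QuestionMark

/-! ### The functional equations of `?` -/

theorem tsum_term_fract (x : ℝ) : ∑' n, term (Int.fract x) n = ∑' n, term x n := by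
  by_cases h : Int.fract x = 0
  · rw [tsum_term_of_fract_eq h, tsum_term_of_fract_eq (by simpa using h)]
  · rw [tsum_term_of_fract_ne h, tsum_term_of_fract_ne (by simpa using h), Int.fract_fract]

theorem questionMark_add_intCast (x : ℝ) (n : ℤ) :
    questionMark (x + n) = questionMark x + n := by
  unfold questionMark
  rw [← tsum_term_fract (x + n), Int.fract_add_intCast, tsum_term_fract, Int.floor_add_intCast]
  push_cast
  ring

theorem questionMark_zero : questionMark 0 = 0 := by
  simp [questionMark, term_of_fract_eq]

theorem questionMark_one : questionMark 1 = 1 := by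
  simp [questionMark, term_of_fract_eq]

/-- Prepending the partial quotient `n + 1`. -/
theorem questionMark_inv_natCast_add (n : ℕ) {y : ℝ} (hy : y ∈ Set.Icc (0 : ℝ) 1) :
    questionMark (n + 1 + y)⁻¹ = (1 / 2) ^ (n + 1) * (2 - questionMark y) := by
  obtain ⟨hy0, hy1⟩ := hy
  have hn : (0 : ℝ) ≤ n := n.cast_nonneg
  rcases eq_or_lt_of_le (show (1 : ℝ) ≤ n + 1 + y by linarith) with h1 | h1
  · have hn0 : (n : ℝ) = 0 := by linarith
    have hy0 : y = 0 := by linarith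
    have : n = 0 := by exact_mod_cast hn0
    subst this
    subst hy0
    norm_num [questionMark_zero, questionMark_one]
  have hpos : (0 : ℝ) < (n + 1 + y)⁻¹ := by positivity
  have hlt : (n + 1 + y : ℝ)⁻¹ < 1 := inv_lt_one_of_one_lt₀ h1
  have hfr : Int.fract (n + 1 + y : ℝ)⁻¹ = (n + 1 + y : ℝ)⁻¹ :=
    Int.fract_eq_self.2 ⟨hpos.le, hlt⟩
  have hfl : ⌊(n + 1 + y : ℝ)⁻¹⌋ = 0 := Int.floor_eq_zero_iff.2 ⟨hpos.le, hlt⟩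
  have hcast : (n + 1 + y : ℝ) = y + ((n + 1 : ℤ) : ℝ) := by push_cast; ring
  have key : questionMark (n + 1 + y : ℝ)⁻¹ =
      (2 : ℝ) ^ (-(⌊(n + 1 + y : ℝ)⌋ : ℝ)) * (2 - ∑' k, term y k) := by
    rw [questionMark, hfl, tsum_term_of_fract_ne (by rw [hfr]; exact hpos.ne'), hfr, inv_inv,
      ← tsum_term_fract (n + 1 + y : ℝ), hcast, Int.fract_add_intCast, tsum_term_fract]
    simp
  have hfloor : ⌊(n + 1 + y : ℝ)⌋ = ⌊y⌋ + (n + 1) := by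
    rw [hcast, Int.floor_add_intCast]
  have hpow : (2 : ℝ) ^ (-((n + 1 : ℕ) : ℝ)) = (1 / 2) ^ (n + 1) := by
    rw [Real.rpow_neg two_pos.le, Real.rpow_natCast, one_div, inv_pow]
  rw [key, hfloor]
  rcases eq_or_lt_of_le hy1 with rfl | hy1
  · rw [questionMark_one, tsum_term_of_fract_eq (by simp)]
    have : (-(((⌊(1 : ℝ)⌋ + (n + 1) : ℤ)) : ℝ)) = -((n + 1 : ℕ) : ℝ) + -1 := by
      rw [Int.floor_one]; push_cast; ring
    rw [this, Real.rpow_add two_pos, hpow, Real.rpow_neg_one]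
    ring
  · have h0 : ⌊y⌋ = 0 := Int.floor_eq_zero_iff.2 ⟨hy0, hy1⟩
    rw [questionMark, h0, zero_add, Int.cast_zero, zero_add, ← hpow]
    push_cast
    rfl

theorem questionMark_one_sub_of_le_half {x : ℝ} (h0 : 0 ≤ x) (hx : x ≤ 1 / 2) :
    questionMark (1 - x) = 1 - questionMark x := by
  rcases eq_or_lt_of_le h0 with rfl | h0
  · simp [questionMark_zero, questionMark_one]
  have hinv : (2 : ℝ) ≤ x⁻¹ := by
    rw [le_inv_comm₀ two_pos h0]
    linarith
  obtain ⟨m, hm⟩ : ∃ m : ℕ, ⌊x⁻¹⌋ = (m : ℤ) + 2 := by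
    have : (2 : ℤ) ≤ ⌊x⁻¹⌋ := Int.le_floor.2 (by exact_mod_cast hinv)
    exact ⟨(⌊x⁻¹⌋ - 2).toNat, by omega⟩
  have hy : Int.fract x⁻¹ ∈ Set.Icc (0 : ℝ) 1 :=
    ⟨Int.fract_nonneg _, (Int.fract_lt_one _).le⟩
  have hxinv : x⁻¹ = (m + 1 : ℕ) + 1 + Int.fract x⁻¹ := by
    have := Int.floor_add_fract x⁻¹
    rw [hm] at this
    push_cast at this ⊢
    linarith
  have hx1 : x = ((m + 1 : ℕ) + 1 + Int.fract x⁻¹)⁻¹ := by rw [← hxinv, inv_inv]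
  have hsub : (1 - x) ≠ 0 := by linarith
  have hx2 : x / (1 - x) = (m + 1 + Int.fract x⁻¹)⁻¹ := by
    have : (m : ℝ) + 1 + Int.fract x⁻¹ = x⁻¹ - 1 := by push_cast at hxinv; linarith
    rw [this]
    field_simp
  have hmem : x / (1 - x) ∈ Set.Icc (0 : ℝ) 1 :=
    ⟨div_nonneg h0.le (by linarith), (div_le_one (by linarith)).2 (by linarith)⟩
  have hx3 : 1 - x = ((0 : ℕ) + 1 + x / (1 - x))⁻¹ := by
    push_cast
    field_simp
    ring
  have e1 := questionMark_inv_natCast_add (m + 1) hy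
  have e2 := questionMark_inv_natCast_add m hy
  have e3 := questionMark_inv_natCast_add 0 hmem
  rw [← hx1] at e1
  rw [← hx2] at e2
  rw [← hx3] at e3
  rw [e3, e2, e1]
  ring

theorem questionMark_one_sub {x : ℝ} (hx : x ∈ Set.Icc (0 : ℝ) 1) :
    questionMark (1 - x) = 1 - questionMark x := by
  rcases le_total x (1 / 2) with h | h
  · exact questionMark_one_sub_of_le_half hx.1 h
  · have := questionMark_one_sub_of_le_half (x := 1 - x) (by linarith [hx.2]) (by linarith)
    rw [sub_sub_cancel] at this
    linarith

/-- The inverse branch `c ↦ 1 / (j + 2 - c)` of the continued fraction map with minus signs,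
`x = 1 / (a₁ - 1 / (a₂ - ⋯))` with `aᵢ ≥ 2`, that prepends `a₁ = j + 2`. -/
noncomputable def branch (j : ℕ) (c : ℝ) : ℝ := (j + 2 - c)⁻¹

theorem branch_denom_pos (j : ℕ) {c : ℝ} (hc : c ≤ 1) : 0 < (j + 2 - c : ℝ) := by
  have : (0 : ℝ) ≤ j := j.cast_nonneg
  linarith

theorem branch_pos (j : ℕ) {c : ℝ} (hc : c ≤ 1) : 0 < branch j c :=
  inv_pos.2 (branch_denom_pos j hc)

theorem branch_one (j : ℕ) : branch j 1 = ((j : ℝ) + 1)⁻¹ := by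
  rw [branch]
  congr 1
  ring

theorem branch_le_branch (j : ℕ) {c d : ℝ} (hcd : c ≤ d) (hd : d ≤ 1) :
    branch j c ≤ branch j d :=
  inv_anti₀ (branch_denom_pos j hd) (by linarith)

theorem branch_le_one (j : ℕ) {c : ℝ} (hc : c ≤ 1) : branch j c ≤ 1 := by
  have : (0 : ℝ) ≤ j := j.cast_nonneg
  exact inv_le_one_of_one_le₀ (by linarith)

theorem branch_mem_Icc (j : ℕ) {c : ℝ} (hc : c ∈ Set.Icc (0 : ℝ) 1) :
    branch j c ∈ Set.Icc (0 : ℝ) 1 :=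
  ⟨(branch_pos j hc.2).le, branch_le_one j hc.2⟩

theorem branch_lt_one (j : ℕ) {c : ℝ} (hc : c < 1) : branch j c < 1 := by
  have : (0 : ℝ) ≤ j := j.cast_nonneg
  exact inv_lt_one_of_one_lt₀ (by linarith)

theorem continuousOn_branch (j : ℕ) : ContinuousOn (branch j) (Set.Icc 0 1) :=
  (by fun_prop : Continuous fun c : ℝ => (j + 2 - c : ℝ)).continuousOn.inv₀
    fun _ hc => (branch_denom_pos j hc.2).ne'

theorem measurable_branch (j : ℕ) : Measurable (branch j) := by
  unfold branch
  fun_prop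

/-- The self-similarity of `?` that makes the digits of the continued fraction with minus signs
independent and geometrically distributed under `d?`. -/
theorem questionMark_branch (j : ℕ) {c : ℝ} (hc : c ∈ Set.Icc (0 : ℝ) 1) :
    questionMark (branch j c) = (1 / 2) ^ (j + 1) * (1 + questionMark c) := by
  have h : branch j c = (j + 1 + (1 - c))⁻¹ := by
    rw [branch]
    congr 1
    ring
  rw [h, questionMark_inv_natCast_add j ⟨by linarith [hc.2], by linarith [hc.1]⟩,
    questionMark_one_sub hc]
  ring

/-! ### Continuity of `?` -/

theorem exists_questionMark_near (n : ℕ) : ∀ y ∈ Set.Icc (0 : ℝ) 1,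
    ∃ x ∈ Set.Icc (0 : ℝ) 1, |questionMark x - y| ≤ (1 / 2) ^ n := by
  induction n with
  | zero =>
    intro y hy
    refine ⟨0, by simp, ?_⟩
    rw [questionMark_zero, zero_sub, abs_neg, abs_of_nonneg hy.1, pow_zero]
    exact hy.2
  | succ n ih =>
    intro y hy
    rcases eq_or_lt_of_le hy.1 with rfl | hy0
    · exact ⟨0, by simp, by rw [questionMark_zero]; simp⟩
    -- `y` lies in one of the dyadic intervals `((1/2)^(j+1), (1/2)^j]`
    obtain ⟨j, hj1, hj2⟩ := exists_nat_pow_near_of_lt_one hy0 hy.2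
      (show (0 : ℝ) < 1 / 2 by norm_num) (by norm_num)
    have hp : (0 : ℝ) < (1 / 2) ^ (j + 1) := by positivity
    have hj3 : y ≤ 2 * (1 / 2) ^ (j + 1) := by
      rw [pow_succ]
      linarith
    obtain ⟨x, hx, hxy⟩ := ih (y / (1 / 2) ^ (j + 1) - 1)
      ⟨by rw [sub_nonneg, one_le_div hp]; exact hj1.le,
        by rw [sub_le_iff_le_add, div_le_iff₀ hp]; linarith⟩
    refine ⟨branch j x, branch_mem_Icc j hx, ?_⟩
    have : questionMark (branch j x) - y =
        (1 / 2) ^ (j + 1) * (questionMark x - (y / (1 / 2) ^ (j + 1) - 1)) := by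
      rw [questionMark_branch j hx]
      field_simp
      ring
    rw [this, abs_mul, abs_of_pos hp, pow_succ (1 / 2 : ℝ) n, mul_comm ((1 / 2 : ℝ) ^ n)]
    refine mul_le_mul ?_ hxy (abs_nonneg _) (by norm_num)
    rw [pow_succ]
    exact mul_le_of_le_one_left (by norm_num) (pow_le_one₀ (by norm_num) (by norm_num))

theorem continuous_questionMark : Continuous questionMark := by
  refine monotone_questionMark.continuous_of_denseRange (Metric.denseRange_iff.2 fun y r hr => ?_)
  obtain ⟨n, hn⟩ := exists_pow_lt_of_lt_one hr (show (1 / 2 : ℝ) < 1 by norm_num)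
  obtain ⟨x, -, hx⟩ := exists_questionMark_near n (Int.fract y)
    ⟨Int.fract_nonneg _, (Int.fract_lt_one _).le⟩
  refine ⟨x + ⌊y⌋, ?_⟩
  rw [questionMark_add_intCast, dist_comm, Real.dist_eq,
    show questionMark x + ⌊y⌋ - y = questionMark x - Int.fract y by unfold Int.fract; ring]
  exact hx.trans_lt hn

/-! ### The measure `d?` -/

theorem coe_stieltjesFunction_questionMark :
    ⇑monotone_questionMark.stieltjesFunction = questionMark := by
  ext x
  rw [Monotone.stieltjesFunction_eq]
  exact continuous_questionMark.continuousAt.continuousWithinAt.rightLim_eq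

theorem dQuestionMark_Ioc (a b : ℝ) :
    dQuestionMark (Set.Ioc a b) = ENNReal.ofReal (questionMark b - questionMark a) := by
  rw [dQuestionMark, StieltjesFunction.measure_Ioc, coe_stieltjesFunction_questionMark]

theorem isFiniteMeasure_restrict_dQuestionMark (a b : ℝ) :
    IsFiniteMeasure (dQuestionMark.restrict (Set.Ioc a b)) := ⟨by simp [dQuestionMark_Ioc]⟩

theorem dQuestionMark_real_Ioc_zero_one : dQuestionMark.real (Set.Ioc 0 1) = 1 := by
  simp [measureReal_def, dQuestionMark_Ioc, questionMark_one, questionMark_zero]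

instance nullSingletonClass_dQuestionMark : NullSingletonClass dQuestionMark := ⟨fun x => by
  rw [dQuestionMark, StieltjesFunction.measure_singleton, coe_stieltjesFunction_questionMark,
    continuous_questionMark.continuousAt.continuousWithinAt.leftLim_eq]
  simp⟩

/-- The pieces of `d?` on the images of the branches are scaled copies of `d?` on `(0, 1]`. -/
theorem restrict_dQuestionMark_Ioc_branch (j : ℕ) :
    dQuestionMark.restrict (Set.Ioc (branch j 0) (branch j 1)) =
      ENNReal.ofReal ((1 / 2) ^ (j + 1)) •
        (dQuestionMark.restrict (Set.Ioc 0 1)).map (branch j) := by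
  have := isFiniteMeasure_restrict_dQuestionMark 0 1
  have := isFiniteMeasure_restrict_dQuestionMark (branch j 0) (branch j 1)
  have : IsFiniteMeasure (ENNReal.ofReal ((1 / 2) ^ (j + 1)) •
      (dQuestionMark.restrict (Set.Ioc 0 1)).map (branch j)) :=
    ⟨by
      rw [Measure.smul_apply, Measure.map_apply (measurable_branch j) MeasurableSet.univ, smul_eq_mul]
      exact ENNReal.mul_lt_top ENNReal.ofReal_lt_top (by simp [dQuestionMark_Ioc])⟩
  refine Measure.ext_of_Iic _ _ fun x => ?_
  rw [Measure.smul_apply, Measure.map_apply (measurable_branch j) measurableSet_Iic,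
    Measure.restrict_apply measurableSet_Iic,
    Measure.restrict_apply (measurable_branch j measurableSet_Iic), smul_eq_mul]
  rcases le_or_gt x (branch j 0) with hx0 | hx0
  · have e1 : Set.Iic x ∩ Set.Ioc (branch j 0) (branch j 1) = ∅ := by
      ext z
      simp only [Set.mem_inter_iff, Set.mem_Iic, Set.mem_Ioc, Set.mem_empty_iff_false, iff_false]
      intro h
      linarith [h.1, h.2.1]
    have e2 : branch j ⁻¹' Set.Iic x ∩ Set.Ioc 0 1 = ∅ := by
      ext z
      simp only [Set.mem_inter_iff, Set.mem_preimage, Set.mem_Iic, Set.mem_Ioc,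
        Set.mem_empty_iff_false, iff_false]
      rintro ⟨h1, h2, h3⟩
      have : branch j 0 < branch j z := inv_strictAnti₀ (branch_denom_pos j h3) (by linarith)
      linarith
    rw [e1, e2]
    simp
  -- above `branch j 0`, the sublevel set of `branch j` is `c ≤ c₀` with `c₀` as below
  obtain ⟨c₀, hc₀, hc₀1, hcx⟩ : ∃ c₀, 0 ≤ c₀ ∧ c₀ ≤ 1 ∧ branch j c₀ = min x (branch j 1) := by
    have := (intermediate_value_Icc zero_le_one (continuousOn_branch j))
      (show min x (branch j 1) ∈ Set.Icc (branch j 0) (branch j 1) from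
        ⟨le_min hx0.le (branch_le_branch j zero_le_one le_rfl), min_le_right _ _⟩)
    obtain ⟨c, hc, h⟩ := this
    exact ⟨c, hc.1, hc.2, h⟩
  have e1 : Set.Iic x ∩ Set.Ioc (branch j 0) (branch j 1) =
      Set.Ioc (branch j 0) (branch j c₀) := by
    ext z
    simp only [hcx, Set.mem_inter_iff, Set.mem_Iic, Set.mem_Ioc, le_min_iff]
    tauto
  have e2 : branch j ⁻¹' Set.Iic x ∩ Set.Ioc 0 1 = Set.Ioc 0 c₀ := by
    ext z
    simp only [Set.mem_inter_iff, Set.mem_preimage, Set.mem_Iic, Set.mem_Ioc]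
    constructor
    · rintro ⟨h1, h2, h3⟩
      refine ⟨h2, le_of_not_gt fun h => ?_⟩
      have h4 : branch j c₀ < branch j z := inv_strictAnti₀ (branch_denom_pos j h3) (by linarith)
      rw [hcx] at h4
      exact absurd (le_min h1 (branch_le_branch j h3 le_rfl)) (not_le.2 h4)
    · rintro ⟨h1, h2⟩
      exact ⟨(branch_le_branch j h2 hc₀1).trans (hcx ▸ min_le_left _ _), h1, h2.trans hc₀1⟩
  rw [e1, e2, dQuestionMark_Ioc, dQuestionMark_Ioc, questionMark_branch j ⟨hc₀, hc₀1⟩,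
    questionMark_branch j ⟨le_rfl, zero_le_one⟩, ← ENNReal.ofReal_mul (by positivity)]
  congr 1
  ring

/-! ### The transfer operator of the branches -/

/-- The averaging operator `f ↦ 𝔼 f(1 / (A - c))`, where `A = j + 2` with probability
`2^{-(j+1)}`. -/
noncomputable def transfer (f : ℝ → ℝ) (c : ℝ) : ℝ := ∑' j : ℕ, (1 / 2) ^ (j + 1) * f (branch j c)

theorem hasSum_half_pow_succ : HasSum (fun j : ℕ => (1 / 2 : ℝ) ^ (j + 1)) 1 := by
  have := hasSum_geometric_two.mul_left (1 / 2 : ℝ)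
  simp_rw [pow_succ']
  simpa using this

/-- Continuous functions `[0, 1] → [0, 1]` which are nondecreasing on `[0, 1)` and there have
increments at most `κ (y - x) / (1 - y)`. The factor `1 / (1 - y)` compensates the neutral fixed
point `1` of `branch 0`, where no Lipschitz condition is contracted by the factor `1 / 2`. -/
structure IncrementBound (κ : ℝ) (f : ℝ → ℝ) : Prop where
  continuousOn : ContinuousOn f (Set.Icc 0 1)
  mem_Icc : ∀ x ∈ Set.Icc (0 : ℝ) 1, f x ∈ Set.Icc (0 : ℝ) 1
  mono : ∀ x y, 0 ≤ x → x ≤ y → y < 1 → f x ≤ f y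
  sub_le : ∀ x y, 0 ≤ x → x ≤ y → y < 1 → f y - f x ≤ κ * ((y - x) / (1 - y))

theorem IncrementBound.summable {κ : ℝ} {f : ℝ → ℝ} (hf : IncrementBound κ f) {c : ℝ}
    (hc : c ∈ Set.Icc (0 : ℝ) 1) : Summable fun j : ℕ => (1 / 2) ^ (j + 1) * f (branch j c) := by
  refine Summable.of_nonneg_of_le (fun j => ?_) (fun j => ?_) hasSum_half_pow_succ.summable
  · exact mul_nonneg (by positivity) (hf.mem_Icc _ (branch_mem_Icc j hc)).1
  · exact mul_le_of_le_one_right (by positivity) (hf.mem_Icc _ (branch_mem_Icc j hc)).2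

theorem incrementBound_pow {L : ℕ} : IncrementBound 1 fun x => x ^ L where
  continuousOn := (continuous_pow L).continuousOn
  mem_Icc x hx := ⟨pow_nonneg hx.1 L, pow_le_one₀ hx.1 hx.2⟩
  mono x y hx hxy _ := pow_le_pow_left₀ hx hxy L
  sub_le x y hx hxy hy := by
    have h1 : (0 : ℝ) < 1 - y := by linarith
    have h0 : 0 ≤ y := hx.trans hxy
    -- `y^L - x^L = (y - x) ∑ y^i x^(L-1-i)` and `(1 - y) ∑ y^i ≤ 1`
    rw [one_mul, le_div_iff₀ h1, ← (Commute.all y x).geom_sum₂_mul L, mul_comm, ← mul_assoc]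
    refine mul_le_of_le_one_left (by linarith) ?_
    calc (1 - y) * ∑ i ∈ Finset.range L, y ^ i * x ^ (L - 1 - i)
        ≤ (1 - y) * ∑ i ∈ Finset.range L, y ^ i := by
          gcongr with i
          exact mul_le_of_le_one_right (by positivity) (pow_le_one₀ hx (by linarith))
      _ = 1 - y ^ L := mul_neg_geom_sum y L
      _ ≤ 1 := by linarith [pow_nonneg h0 L]

/-- The weight `(y - x) / (1 - y)` is contracted by the factor `1 / 2` under averaging over the
branches. Here `v = 1 - x` and `u = 1 - y`. -/
theorem tsum_branch_weight_le {u v : ℝ} (hu : 0 < u) (huv : u ≤ v) :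
    ∑' j : ℕ, (1 / 2 : ℝ) ^ (j + 1) * (1 / ((j + 1 + v) * (j + u))) ≤ 1 / 2 * (1 / u) := by
  have hv : 0 < v := hu.trans_le huv
  have hle : ∀ j : ℕ, (1 / 2 : ℝ) ^ (j + 1 + 1) * (1 / (((j + 1 : ℕ) + 1 + v) * ((j + 1 : ℕ) + u)))
      ≤ (1 / 2 : ℝ) ^ (j + 1) * (1 / 2 * (1 / ((2 + v) * (1 + u)))) := by
    intro j
    rw [pow_succ (1 / 2 : ℝ) (j + 1), mul_assoc]
    have : (0 : ℝ) ≤ j := j.cast_nonneg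
    push_cast
    gcongr <;> linarith
  have hsum := hasSum_half_pow_succ.mul_right (1 / 2 * (1 / ((2 + v) * (1 + u))))
  have hs1 : Summable fun j : ℕ =>
      (1 / 2 : ℝ) ^ (j + 1 + 1) * (1 / (((j + 1 : ℕ) + 1 + v) * ((j + 1 : ℕ) + u))) :=
    Summable.of_nonneg_of_le (fun j => by positivity) hle hsum.summable
  have hs : Summable fun j : ℕ => (1 / 2 : ℝ) ^ (j + 1) * (1 / ((j + 1 + v) * (j + u))) :=
    (summable_nat_add_iff (f := fun j : ℕ =>
      (1 / 2 : ℝ) ^ (j + 1) * (1 / ((j + 1 + v) * (j + u)))) 1).1 hs1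
  rw [hs.tsum_eq_zero_add]
  have h2 := (hs1.tsum_le_tsum hle hsum.summable).trans_eq hsum.tsum_eq
  have h3 : 1 / ((2 + v) * (1 + u)) ≤ 1 / u - 1 / ((1 + v) * u) := by
    have : 1 / u - 1 / ((1 + v) * u) = v / ((1 + v) * u) := by
      field_simp
      ring
    rw [this, div_le_div_iff₀ (by positivity) (by positivity)]
    nlinarith [mul_pos hu hv]
  have h4 : (1 / 2 : ℝ) ^ (0 + 1) * (1 / (((0 : ℕ) + 1 + v) * ((0 : ℕ) + u))) =
      1 / 2 * (1 / ((1 + v) * u)) := by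
    push_cast
    ring
  rw [h4]
  linarith

theorem summable_branch_weight {u v : ℝ} (hu : 0 < u) (huv : u ≤ v) :
    Summable fun j : ℕ => (1 / 2 : ℝ) ^ (j + 1) * (1 / ((j + 1 + v) * (j + u))) := by
  have hv : 0 < v := hu.trans_le huv
  refine Summable.of_nonneg_of_le (fun j => by positivity) (fun j => ?_)
    (hasSum_half_pow_succ.summable.mul_right (1 / (v * u)))
  have : (0 : ℝ) ≤ j := j.cast_nonneg
  gcongr <;> linarith

theorem branch_weight_eq (j : ℕ) {x y : ℝ} (hxy : x ≤ y) (hy : y < 1) :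
    (branch j y - branch j x) / (1 - branch j y) =
      (y - x) * (1 / ((j + 1 + (1 - x)) * (j + (1 - y)))) := by
  have hj : (0 : ℝ) ≤ j := j.cast_nonneg
  have h1 : (j + 2 - y : ℝ) ≠ 0 := (branch_denom_pos j hy.le).ne'
  have h2 : (j + 2 - x : ℝ) ≠ 0 := (branch_denom_pos j (hxy.trans hy.le)).ne'
  have h3 : (j + (1 - y) : ℝ) ≠ 0 := by
    have : (0 : ℝ) < j + (1 - y) := by linarith
    exact this.ne'
  have e1 : 1 - branch j y = (j + (1 - y)) / (j + 2 - y) := by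
    rw [branch, eq_div_iff h1, sub_mul, inv_mul_cancel₀ h1]
    ring
  have e2 : branch j y - branch j x = (y - x) / ((j + 2 - x) * (j + 2 - y)) := by
    rw [branch, branch, inv_sub_inv h1 h2]
    rw [mul_comm]
    congr 1
    ring
  rw [e1, e2, show (j + 1 + (1 - x) : ℝ) = j + 2 - x by ring]
  field_simp

theorem IncrementBound.transfer {κ : ℝ} {f : ℝ → ℝ} (hκ : 0 ≤ κ) (hf : IncrementBound κ f) :
    IncrementBound (κ / 2) (transfer f) where
  continuousOn := by
    refine continuousOn_tsum (u := fun j : ℕ => (1 / 2 : ℝ) ^ (j + 1)) (fun j => ?_)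
      hasSum_half_pow_succ.summable fun j x hx => ?_
    · exact continuousOn_const.mul
        (hf.continuousOn.comp (continuousOn_branch j) fun c hc => branch_mem_Icc j hc)
    · have := hf.mem_Icc _ (branch_mem_Icc j hx)
      rw [Real.norm_of_nonneg (mul_nonneg (by positivity) this.1)]
      exact mul_le_of_le_one_right (by positivity) this.2
  mem_Icc x hx := by
    refine ⟨tsum_nonneg fun j =>
      mul_nonneg (by positivity) (hf.mem_Icc _ (branch_mem_Icc j hx)).1, ?_⟩
    refine ((hf.summable hx).tsum_le_tsum (fun j => ?_) hasSum_half_pow_succ.summable).trans_eq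
      hasSum_half_pow_succ.tsum_eq
    exact mul_le_of_le_one_right (by positivity) (hf.mem_Icc _ (branch_mem_Icc j hx)).2
  mono x y hx hxy hy := by
    refine (hf.summable ⟨hx, hxy.trans hy.le⟩).tsum_le_tsum (fun j => ?_)
      (hf.summable ⟨hx.trans hxy, hy.le⟩)
    exact mul_le_mul_of_nonneg_left (hf.mono _ _ (branch_pos j (hxy.trans hy.le)).le
      (branch_le_branch j hxy hy.le) (branch_lt_one j hy)) (by positivity)
  sub_le x y hx hxy hy := by
    have hsx := hf.summable ⟨hx, hxy.trans hy.le⟩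
    have hsy := hf.summable ⟨hx.trans hxy, hy.le⟩
    have hu : 0 < 1 - y := by linarith
    have huv : 1 - y ≤ 1 - x := by linarith
    unfold QuestionMark.transfer
    rw [← hsy.tsum_sub hsx]
    calc _ ≤ ∑' j : ℕ, κ * (y - x) *
          ((1 / 2 : ℝ) ^ (j + 1) * (1 / ((j + 1 + (1 - x)) * (j + (1 - y))))) := by
          refine (hsy.sub hsx).tsum_le_tsum (fun j => ?_)
            ((summable_branch_weight hu huv).mul_left _)
          have h := hf.sub_le _ _ (branch_pos j (hxy.trans hy.le)).le
            (branch_le_branch j hxy hy.le) (branch_lt_one j hy)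
          rw [branch_weight_eq j hxy hy] at h
          rw [← mul_sub]
          refine (mul_le_mul_of_nonneg_left h (by positivity)).trans_eq ?_
          ring
      _ ≤ κ * (y - x) * (1 / 2 * (1 / (1 - y))) := by
          rw [tsum_mul_left]
          exact mul_le_mul_of_nonneg_left (tsum_branch_weight_le hu huv)
            (mul_nonneg hκ (by linarith))
      _ = κ / 2 * ((y - x) / (1 - y)) := by ring

/-- The iterates of `transfer` on `x ↦ x ^ L`: the value at `0` is the `L`-th moment of the `ℓ`-th
convergent of a random continued fraction with minus signs. -/
noncomputable def transferPow (L ℓ : ℕ) : ℝ → ℝ := transfer^[ℓ] fun x => x ^ L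

theorem transferPow_succ (L ℓ : ℕ) : transferPow L (ℓ + 1) = transfer (transferPow L ℓ) :=
  Function.iterate_succ_apply' _ _ _

theorem incrementBound_transferPow (L ℓ : ℕ) : IncrementBound ((1 / 2) ^ ℓ) (transferPow L ℓ) := by
  induction ℓ with
  | zero => exact incrementBound_pow
  | succ ℓ ih =>
    rw [transferPow_succ, pow_succ, ← div_eq_mul_one_div]
    exact ih.transfer (by positivity)

theorem transferPow_zero_le_succ (L ℓ : ℕ) : transferPow L ℓ 0 ≤ transferPow L (ℓ + 1) 0 ∧
    transferPow L (ℓ + 1) 0 - transferPow L ℓ 0 ≤ (1 / 2) ^ ℓ := by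
  have hf := incrementBound_transferPow L ℓ
  have h0 : (0 : ℝ) ∈ Set.Icc (0 : ℝ) 1 := ⟨le_rfl, zero_le_one⟩
  have hs := hf.summable h0
  rw [transferPow_succ, transfer]
  constructor
  · rw [← one_mul (transferPow L ℓ 0), ← (hasSum_half_pow_succ.mul_right _).tsum_eq]
    refine (hasSum_half_pow_succ.mul_right _).summable.tsum_le_tsum (fun j => ?_) hs
    exact mul_le_mul_of_nonneg_left (hf.mono _ _ le_rfl (branch_pos j zero_le_one).le
      (branch_lt_one j zero_lt_one)) (by positivity)
  · rw [sub_le_iff_le_add, ← one_mul (_ + _), ← (hasSum_half_pow_succ.mul_right _).tsum_eq]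
    refine hs.tsum_le_tsum (fun j => ?_) (hasSum_half_pow_succ.mul_right _).summable
    refine mul_le_mul_of_nonneg_left ?_ (by positivity)
    have h := hf.sub_le 0 (branch j 0) le_rfl (branch_pos j zero_le_one).le
      (branch_lt_one j zero_lt_one)
    have hj : (0 : ℝ) ≤ j := j.cast_nonneg
    have hw : (branch j 0 - 0) / (1 - branch j 0) ≤ 1 := by
      rw [div_le_one (by linarith [branch_lt_one j zero_lt_one])]
      have : branch j 0 ≤ 2⁻¹ := inv_anti₀ two_pos (by linarith)
      linarith
    have := mul_le_of_le_one_right (show (0 : ℝ) ≤ (1 / 2) ^ ℓ by positivity) hw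
    linarith

/-! ### Invariance of `d?` under the random branches -/

theorem iUnion_Ioc_branch : ⋃ j : ℕ, Set.Ioc (branch j 0) (branch j 1) = Set.Ioc 0 1 := by
  ext x
  simp only [Set.mem_iUnion, Set.mem_Ioc]
  constructor
  · rintro ⟨j, h1, h2⟩
    exact ⟨(branch_pos j zero_le_one).trans h1, h2.trans (branch_le_one j le_rfl)⟩
  · rintro ⟨h0, h1⟩
    have hinv : 1 ≤ x⁻¹ := (one_le_inv₀ h0).2 h1
    have hfl : 1 ≤ ⌊x⁻¹⌋₊ := Nat.le_floor (by exact_mod_cast hinv)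
    obtain ⟨j, hj⟩ := Nat.exists_eq_add_of_le' hfl
    have h2 := Nat.floor_le (zero_le_one.trans hinv)
    have h3 := Nat.lt_floor_add_one x⁻¹
    rw [hj] at h2 h3
    push_cast at h2 h3
    have hj0 : (0 : ℝ) ≤ j := j.cast_nonneg
    refine ⟨j, ?_, ?_⟩
    · rw [branch, inv_lt_comm₀ (by linarith) h0]
      linarith
    · rw [branch_one, le_inv_comm₀ h0 (by linarith)]
      exact h2

theorem pairwise_disjoint_Ioc_branch :
    Pairwise (Function.onFun Disjoint fun j : ℕ => Set.Ioc (branch j 0) (branch j 1)) := by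
  refine (pairwise_disjoint_on _).2 fun i j hij => ?_
  rw [Set.disjoint_left]
  rintro x ⟨hx, -⟩ ⟨-, hx'⟩
  have hij' : (i : ℝ) + 1 ≤ j := by exact_mod_cast hij
  have hi : (0 : ℝ) ≤ i := i.cast_nonneg
  have : branch j 1 ≤ branch i 0 := inv_anti₀ (by linarith) (by linarith)
  linarith

theorem IncrementBound.integrableOn {κ : ℝ} {f : ℝ → ℝ} (hf : IncrementBound κ f) :
    IntegrableOn f (Set.Ioc 0 1) dQuestionMark := by
  have := isFiniteMeasure_restrict_dQuestionMark 0 1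
  refine Integrable.of_bound ((hf.continuousOn.mono
    Set.Ioc_subset_Icc_self).aestronglyMeasurable measurableSet_Ioc) 1 ?_
  filter_upwards [ae_restrict_mem measurableSet_Ioc] with x hx
  have := hf.mem_Icc x (Set.Ioc_subset_Icc_self hx)
  rw [Real.norm_of_nonneg this.1]
  exact this.2

theorem IncrementBound.integrableOn_comp_branch {κ : ℝ} {f : ℝ → ℝ} (hf : IncrementBound κ f)
    (j : ℕ) : IntegrableOn (fun x => f (branch j x)) (Set.Ioc 0 1) dQuestionMark := by
  have := isFiniteMeasure_restrict_dQuestionMark 0 1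
  refine Integrable.of_bound (((hf.continuousOn.comp (continuousOn_branch j)
    fun c hc => branch_mem_Icc j hc).mono
    Set.Ioc_subset_Icc_self).aestronglyMeasurable measurableSet_Ioc) 1 ?_
  filter_upwards [ae_restrict_mem measurableSet_Ioc] with x hx
  have := hf.mem_Icc _ (branch_mem_Icc j (Set.Ioc_subset_Icc_self hx))
  rw [Real.norm_of_nonneg this.1]
  exact this.2

theorem integral_transfer {κ : ℝ} {f : ℝ → ℝ} (hf : IncrementBound κ f) :
    ∫ x in Set.Ioc 0 1, transfer f x ∂dQuestionMark = ∫ x in Set.Ioc 0 1, f x ∂dQuestionMark := by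
  have hpiece : ∀ j, ∫ x in Set.Ioc (branch j 0) (branch j 1), f x ∂dQuestionMark =
      ∫ x in Set.Ioc 0 1, (1 / 2) ^ (j + 1) * f (branch j x) ∂dQuestionMark := fun j => by
    have hsm : AEStronglyMeasurable f
        ((dQuestionMark.restrict (Set.Ioc 0 1)).map (branch j)) := by
      have h1 : AEStronglyMeasurable f
          (dQuestionMark.restrict (Set.Ioc (branch j 0) (branch j 1))) :=
        (hf.integrableOn.mono_set (Set.Ioc_subset_Ioc (branch_pos j zero_le_one).le
          (branch_le_one j le_rfl))).aestronglyMeasurable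
      rw [restrict_dQuestionMark_Ioc_branch] at h1
      exact h1.mono_ac (Measure.absolutelyContinuous_smul
        (ENNReal.ofReal_pos.2 (by positivity)).ne')
    rw [restrict_dQuestionMark_Ioc_branch, integral_smul_measure,
      integral_map (measurable_branch j).aemeasurable hsm, ENNReal.toReal_ofReal (by positivity),
      integral_const_mul, smul_eq_mul]
  have hleft := hasSum_integral_of_summable_integral_norm
    (F := fun (j : ℕ) (x : ℝ) => (1 / 2 : ℝ) ^ (j + 1) * f (branch j x))
    (μ := dQuestionMark.restrict (Set.Ioc 0 1))
    (fun j => (hf.integrableOn_comp_branch j).const_mul _) (by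
      refine Summable.of_nonneg_of_le (fun j => integral_nonneg fun x => norm_nonneg _)
        (fun j => ?_) hasSum_half_pow_succ.summable
      have := isFiniteMeasure_restrict_dQuestionMark 0 1
      calc _ ≤ ∫ x in Set.Ioc 0 1, (1 / 2 : ℝ) ^ (j + 1) ∂dQuestionMark := by
            refine integral_mono_ae ((hf.integrableOn_comp_branch j).const_mul _).norm
              (integrable_const _) ?_
            filter_upwards [ae_restrict_mem measurableSet_Ioc] with x hx
            have := hf.mem_Icc _ (branch_mem_Icc j (Set.Ioc_subset_Icc_self hx))
            rw [Real.norm_of_nonneg (mul_nonneg (by positivity) this.1)]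
            exact mul_le_of_le_one_right (by positivity) this.2
        _ = _ := by
            rw [setIntegral_const, dQuestionMark_real_Ioc_zero_one, one_smul])
  have hright := hasSum_integral_iUnion (μ := dQuestionMark) (f := f)
    (fun j : ℕ => (measurableSet_Ioc : MeasurableSet (Set.Ioc (branch j 0) (branch j 1))))
    pairwise_disjoint_Ioc_branch (by rw [iUnion_Ioc_branch]; exact hf.integrableOn)
  rw [iUnion_Ioc_branch] at hright
  simp_rw [hpiece] at hright
  exact hleft.unique hright

/-! ### Convergence of the iterates to the moments -/

theorem moment_eq_integral_transferPow (L ℓ : ℕ) :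
    moment L = ∫ x in Set.Ioc 0 1, transferPow L ℓ x ∂dQuestionMark := by
  induction ℓ with
  | zero =>
    rw [moment, integral_Icc_eq_integral_Ioc]
    rfl
  | succ ℓ ih => rw [ih, transferPow_succ, integral_transfer (incrementBound_transferPow L ℓ)]

theorem tendsto_transferPow_zero (L : ℕ) :
    Filter.Tendsto (fun ℓ => transferPow L ℓ 0) Filter.atTop (nhds (moment L)) := by
  have hfin := isFiniteMeasure_restrict_dQuestionMark 0 1
  have h0 : (0 : ℝ) ∈ Set.Icc (0 : ℝ) 1 := ⟨le_rfl, zero_le_one⟩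
  have hpow : Filter.Tendsto (fun ℓ : ℕ => (1 / 2 : ℝ) ^ ℓ) Filter.atTop (nhds 0) :=
    tendsto_pow_atTop_nhds_zero_of_lt_one (by norm_num) (by norm_num)
  have hdiff : ∀ ℓ, moment L - transferPow L ℓ 0 =
      ∫ x in Set.Ioc 0 1, (transferPow L ℓ x - transferPow L ℓ 0) ∂dQuestionMark := fun ℓ => by
    rw [integral_sub (incrementBound_transferPow L ℓ).integrableOn (integrable_const _),
      setIntegral_const, dQuestionMark_real_Ioc_zero_one, one_smul, ← moment_eq_integral_transferPow]
  have hlim : Filter.Tendsto (fun ℓ => moment L - transferPow L ℓ 0) Filter.atTop (nhds 0) := by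
    simp_rw [hdiff]
    suffices h : Filter.Tendsto (fun ℓ => ∫ x in Set.Ioc 0 1,
        (transferPow L ℓ x - transferPow L ℓ 0) ∂dQuestionMark) Filter.atTop
        (nhds (∫ x in Set.Ioc 0 1, (0 : ℝ) ∂dQuestionMark)) by
      simpa only [integral_zero] using h
    refine tendsto_integral_of_dominated_convergence (fun _ => 1) (fun ℓ => ?_)
      (integrable_const _) (fun ℓ => ?_) ?_
    · exact ((incrementBound_transferPow L ℓ).integrableOn.sub
        (integrable_const _)).aestronglyMeasurable
    · filter_upwards [ae_restrict_mem measurableSet_Ioc] with x hx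
      have h1 := (incrementBound_transferPow L ℓ).mem_Icc x (Set.Ioc_subset_Icc_self hx)
      have h2 := (incrementBound_transferPow L ℓ).mem_Icc 0 h0
      rw [Real.norm_eq_abs, abs_le]
      constructor <;> linarith [h1.1, h1.2, h2.1, h2.2]
    -- the increment bound is useless at `x = 1`, but `d?` has no atom there
    · filter_upwards [ae_restrict_mem measurableSet_Ioc,
        ae_restrict_of_ae (compl_mem_ae_iff.2 (measure_singleton (μ := dQuestionMark) 1))] with x hx hx1
      have hlt : x < 1 := lt_of_le_of_ne hx.2 hx1
      refine squeeze_zero (g := fun ℓ : ℕ => (1 / 2 : ℝ) ^ ℓ * ((x - 0) / (1 - x)))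
        (fun ℓ => ?_) (fun ℓ => ?_) ?_
      · exact sub_nonneg.2 ((incrementBound_transferPow L ℓ).mono 0 x le_rfl hx.1.le hlt)
      · exact (incrementBound_transferPow L ℓ).sub_le 0 x le_rfl hx.1.le hlt
      · simpa using hpow.mul_const ((x - 0) / (1 - x))
  simpa using hlim.const_sub (moment L)

/-! ### The weight and the Bessel kernel -/

/-- The weight `1 / (eˢ (2eˢ - 1))`. -/
noncomputable def weight (s : ℝ) : ℝ := (Real.exp s * (2 * Real.exp s - 1))⁻¹

theorem weight_nonneg {s : ℝ} (hs : 0 ≤ s) : 0 ≤ weight s := by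
  have : 1 ≤ Real.exp s := Real.one_le_exp hs
  exact inv_nonneg.2 (mul_nonneg (by linarith) (by linarith))

@[fun_prop]
theorem measurable_weight : Measurable weight := by
  unfold weight
  fun_prop

theorem hasSum_weight {s : ℝ} (hs : 0 ≤ s) :
    HasSum (fun j : ℕ => (1 / 2 : ℝ) ^ (j + 1) * Real.exp (-((j + 2) * s))) (weight s) := by
  have h1 : 1 ≤ Real.exp s := Real.one_le_exp hs
  have h0 : Real.exp s ≠ 0 := (Real.exp_pos s).ne'
  have hlt : 1 / 2 * (Real.exp s)⁻¹ < 1 := by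
    have : (Real.exp s)⁻¹ ≤ 1 := inv_le_one_of_one_le₀ h1
    linarith
  have h := (hasSum_geometric_of_lt_one (by positivity) hlt).mul_left
    (1 / 2 * (Real.exp s)⁻¹ ^ 2)
  have e : 1 / 2 * (Real.exp s)⁻¹ ^ 2 * (1 - 1 / 2 * (Real.exp s)⁻¹)⁻¹ = weight s := by
    rw [weight]
    have h2 : 2 * Real.exp s - 1 ≠ 0 := by linarith
    have h3 : 1 - 1 / 2 * (Real.exp s)⁻¹ = (2 * Real.exp s - 1) / (2 * Real.exp s) := by
      field_simp
    rw [h3]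
    field_simp
  rw [e] at h
  refine h.congr_fun fun j => ?_
  rw [mul_pow, Real.exp_neg, show ((j : ℝ) + 2) * s = (j + 2 : ℕ) * s by push_cast; rfl,
    Real.exp_nat_mul, inv_pow, inv_pow]
  field_simp
  ring

theorem tsum_ofReal_half_pow_succ : ∑' j : ℕ, ENNReal.ofReal ((1 / 2) ^ (j + 1)) = 1 := by
  rw [← ENNReal.ofReal_tsum_of_nonneg (fun n => by positivity) hasSum_half_pow_succ.summable,
    hasSum_half_pow_succ.tsum_eq, ENNReal.ofReal_one]

theorem lintegral_pow_mul_exp_neg (n : ℕ) {r : ℝ} (hr : 0 < r) :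
    ∫⁻ s in Set.Ioi 0, ENNReal.ofReal (s ^ n * Real.exp (-(r * s))) =
      ENNReal.ofReal (n.factorial * r⁻¹ ^ (n + 1)) := by
  have h : ∫ s in Set.Ioi 0, s ^ n * Real.exp (-(r * s)) = n.factorial * r⁻¹ ^ (n + 1) := by
    have := Real.integral_rpow_mul_exp_neg_mul_Ioi (a := n + 1) (by positivity) hr
    rw [Real.Gamma_nat_eq_factorial, add_sub_cancel_right] at this
    simp_rw [Real.rpow_natCast] at this
    rw [this, one_div, mul_comm]
    congr 1
    exact_mod_cast Real.rpow_natCast r⁻¹ (n + 1)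
  have hint : Integrable (fun s : ℝ => s ^ n * Real.exp (-(r * s)))
      (volume.restrict (Set.Ioi 0)) := by
    refine not_imp_comm.1 integral_undef ?_
    rw [h]
    positivity
  rw [← h, ofReal_integral_eq_lintegral_ofReal hint]
  filter_upwards [ae_restrict_mem measurableSet_Ioi] with s hs
  exact mul_nonneg (pow_nonneg (le_of_lt hs) n) (Real.exp_pos _).le

/-- The Laplace transform of `sⁿ` against the weight, as an average over the branches. -/
theorem lintegral_pow_mul_weight_mul_exp (n : ℕ) {c : ℝ} (hc : c ≤ 1) :
    ∫⁻ s in Set.Ioi 0, ENNReal.ofReal (s ^ n * (weight s * Real.exp (c * s))) =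
      ∑' j : ℕ, ENNReal.ofReal ((1 / 2) ^ (j + 1) * (n.factorial * branch j c ^ (n + 1))) := by
  calc _ = ∫⁻ s in Set.Ioi 0, ∑' j : ℕ, ENNReal.ofReal ((1 / 2) ^ (j + 1)) *
        ENNReal.ofReal (s ^ n * Real.exp (-((j + 2 - c) * s))) := by
        refine setLIntegral_congr_fun measurableSet_Ioi fun s hs => ?_
        have hs0 : 0 ≤ s := le_of_lt hs
        have h := ((hasSum_weight hs0).mul_right (Real.exp (c * s))).mul_left (s ^ n)
        simp_rw [← ENNReal.ofReal_mul (show (0 : ℝ) ≤ (1 / 2) ^ (_ + 1) by positivity)]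
        rw [← ENNReal.ofReal_tsum_of_nonneg (fun j => by positivity)]
        · rw [← h.tsum_eq]
          congr 1
          refine tsum_congr fun j => ?_
          rw [mul_assoc _ (Real.exp _), ← Real.exp_add]
          ring_nf
        · refine h.summable.congr fun j => ?_
          rw [mul_assoc _ (Real.exp _), ← Real.exp_add]
          ring_nf
    _ = _ := by
        rw [lintegral_tsum fun j => by fun_prop]
        refine tsum_congr fun j => ?_
        rw [lintegral_const_mul _ (by fun_prop),
          lintegral_pow_mul_exp_neg n (branch_denom_pos j hc),
          ← ENNReal.ofReal_mul (by positivity)]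
        rfl

/-- The kernel `√(t / s) I₁(2√(ts)) = ∑ tⁿ⁺¹ sⁿ / ((n + 1)! n!)`. -/
noncomputable def kernel (t s : ℝ) : ENNReal :=
  ∑' n : ℕ, ENNReal.ofReal (t ^ (n + 1) / (n + 1).factorial * (s ^ n / n.factorial))

@[fun_prop]
theorem Measurable.kernel {α : Type*} [MeasurableSpace α] {f g : α → ℝ} (hf : Measurable f)
    (hg : Measurable g) : Measurable fun a => kernel (f a) (g a) := by
  unfold QuestionMark.kernel
  fun_prop

/-- The kernel maps `e^{cs}` to an average of the functions `e^{tx} - 1`, with `x` running over the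
images of `c` under the branches. -/
theorem lintegral_kernel_add_one {t c : ℝ} (ht : 0 ≤ t) (hc : c ≤ 1) :
    (∫⁻ s in Set.Ioi 0, kernel t s * ENNReal.ofReal (weight s * Real.exp (c * s))) + 1 =
      ∑' j : ℕ, ENNReal.ofReal ((1 / 2) ^ (j + 1)) *
        ENNReal.ofReal (Real.exp (branch j c * t)) := by
  have hexp : ∀ x : ℝ, 0 ≤ x → (∑' n : ℕ, ENNReal.ofReal (x ^ (n + 1) / (n + 1).factorial)) + 1 =
      ENNReal.ofReal (Real.exp x) := fun x hx => by
    have h : HasSum (fun n : ℕ => x ^ n / n.factorial) (Real.exp x) := by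
      rw [Real.exp_eq_exp_ℝ]
      exact NormedSpace.expSeries_div_hasSum_exp x
    rw [← h.tsum_eq, ENNReal.ofReal_tsum_of_nonneg (fun n => by positivity) h.summable,
      
      tsum_eq_zero_add' (f := fun n : ℕ => ENNReal.ofReal (x ^ n / n.factorial)) ENNReal.summable,
      add_comm]
    simp
  have hint : ∫⁻ s in Set.Ioi 0, kernel t s * ENNReal.ofReal (weight s * Real.exp (c * s)) =
      ∑' j : ℕ, ENNReal.ofReal ((1 / 2) ^ (j + 1)) *
        ∑' n : ℕ, ENNReal.ofReal ((branch j c * t) ^ (n + 1) / (n + 1).factorial) := by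
    calc _ = ∫⁻ s in Set.Ioi 0, ∑' n : ℕ, ENNReal.ofReal
          (t ^ (n + 1) / (n + 1).factorial / n.factorial) *
            ENNReal.ofReal (s ^ n * (weight s * Real.exp (c * s))) := by
          refine setLIntegral_congr_fun measurableSet_Ioi fun s hs => ?_
          have hs0 : 0 ≤ s := le_of_lt hs
          simp only [kernel]
          rw [← ENNReal.tsum_mul_right]
          refine tsum_congr fun n => ?_
          rw [← ENNReal.ofReal_mul (by positivity), ← ENNReal.ofReal_mul (by positivity)]
          congr 1
          ring
      _ = ∑' n : ℕ, ∑' j : ℕ, ENNReal.ofReal ((1 / 2) ^ (j + 1)) *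
            ENNReal.ofReal ((branch j c * t) ^ (n + 1) / (n + 1).factorial) := by
          rw [lintegral_tsum fun n => by fun_prop]
          refine tsum_congr fun n => ?_
          rw [lintegral_const_mul _ (by fun_prop), lintegral_pow_mul_weight_mul_exp n hc,
            ← ENNReal.tsum_mul_left]
          refine tsum_congr fun j => ?_
          rw [← ENNReal.ofReal_mul (by positivity), ← ENNReal.ofReal_mul (by positivity)]
          congr 1
          have : (n.factorial : ℝ) ≠ 0 := by positivity
          rw [mul_pow]
          field_simp
      _ = _ := by
          rw [ENNReal.tsum_comm]
          simp_rw [ENNReal.tsum_mul_left]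
  rw [hint]
  conv_lhs => rw [← tsum_ofReal_half_pow_succ]
  rw [← ENNReal.tsum_add]
  refine tsum_congr fun j => ?_
  rw [← hexp _ (mul_nonneg (branch_pos j hc).le ht), mul_add, mul_one]

theorem summable_besselI₁ (x : ℝ) : Summable fun k : ℕ =>
    (x / 2) ^ (2 * k + 1) / ((k.factorial : ℝ) * ((k + 1).factorial : ℝ)) := by
  refine Summable.of_norm_bounded
    ((Real.summable_pow_div_factorial ((x / 2) ^ 2)).mul_left |x / 2|) fun k => ?_
  have h1 : (1 : ℝ) ≤ ((k + 1).factorial : ℝ) := by exact_mod_cast Nat.factorial_pos _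
  rw [Real.norm_eq_abs, abs_div, abs_of_pos (show (0 : ℝ) < k.factorial * (k + 1).factorial by
    positivity), pow_succ, abs_mul, pow_mul, abs_of_nonneg (show 0 ≤ ((x / 2) ^ 2) ^ k by positivity),
    mul_comm, mul_div_assoc]
  gcongr
  exact le_mul_of_one_le_right (by positivity) h1

@[fun_prop]
theorem measurable_besselI₁ : Measurable besselI₁ :=
  measurable_of_tendsto_metrizable
    (f := fun (N : ℕ) (x : ℝ) => ∑ k ∈ Finset.range N,
      (x / 2) ^ (2 * k + 1) / ((k.factorial : ℝ) * ((k + 1).factorial : ℝ)))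
    (fun N => by fun_prop)
    (tendsto_pi_nhds.2 fun x => (summable_besselI₁ x).hasSum.tendsto_sum_nat)

theorem besselI₁_nonneg {x : ℝ} (hx : 0 ≤ x) : 0 ≤ besselI₁ x :=
  tsum_nonneg fun k => by positivity

theorem kernel_eq_besselI₁ {t s : ℝ} (ht : 0 < t) (hs : 0 < s) :
    kernel t s = ENNReal.ofReal (√t / √s * besselI₁ (2 * √(t * s))) := by
  have ht' : √t ^ 2 = t := Real.sq_sqrt ht.le
  have hs' : √s ^ 2 = s := Real.sq_sqrt hs.le
  have hs0 : √s ≠ 0 := (Real.sqrt_pos.2 hs).ne'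
  rw [besselI₁, ← tsum_mul_left, ENNReal.ofReal_tsum_of_nonneg (fun k => by positivity)
    ((summable_besselI₁ _).mul_left _)]
  refine tsum_congr fun k => ?_
  congr 1
  rw [mul_div_cancel_left₀ _ (two_ne_zero), Real.sqrt_mul ht.le]
  have : √t / √s * ((√t * √s) ^ (2 * k + 1) / ((k.factorial : ℝ) * ((k + 1).factorial : ℝ))) =
      (√t ^ 2) ^ (k + 1) / (k + 1).factorial * ((√s ^ 2) ^ k / k.factorial) := by
    field_simp
    ring
  rw [this, ht', hs']

/-! ### The chain of integrals -/

/-- The integrand in the variables `x 0, …, x ℓ`, for the exponent `L = n + 1` and divided by `n!`,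
with the factors `√(xᵢ / xᵢ₊₁)` distributed over the kernels. -/
noncomputable def chainDensity (n ℓ : ℕ) (x : Fin (ℓ + 1) → ℝ) : ENNReal :=
  ENNReal.ofReal (x 0 ^ n / n.factorial * weight (x 0)) *
    ∏ i : Fin ℓ, (kernel (x i.castSucc) (x i.succ) * ENNReal.ofReal (weight (x i.succ)))

@[fun_prop]
theorem measurable_chainDensity (n ℓ : ℕ) : Measurable (chainDensity n ℓ) := by
  unfold chainDensity
  fun_prop

/-- Lebesgue measure on the open orthant. -/
noncomputable def orthantMeasure (ℓ : ℕ) : Measure (Fin (ℓ + 1) → ℝ) :=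
  Measure.pi fun _ => volume.restrict (Set.Ioi 0)

theorem volume_restrict_orthant (ℓ : ℕ) : volume.restrict (orthant ℓ) = orthantMeasure ℓ := by
  have h : orthant ℓ = Set.pi Set.univ fun _ => Set.Ici 0 := by
    ext x
    simp [orthant, Pi.le_def]
  rw [h, volume_pi, Measure.restrict_pi_pi, orthantMeasure]
  simp_rw [Measure.restrict_congr_set (Ioi_ae_eq_Ici (μ := (volume : Measure ℝ)) (a := 0))]

theorem ae_orthantMeasure_pos (ℓ : ℕ) : ∀ᵐ x ∂orthantMeasure ℓ, ∀ i, 0 < x i := by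
  rw [Filter.eventually_all]
  intro i
  have := (Measure.quasiMeasurePreserving_eval
    (μ := fun _ : Fin (ℓ + 1) => (volume : Measure ℝ).restrict (Set.Ioi 0)) i).ae
      (ae_restrict_mem measurableSet_Ioi)
  exact this

/-- The iterated integral with an additional factor `e^{c xₗ}` in the last variable. -/
noncomputable def chain (n ℓ : ℕ) (c : ℝ) : ENNReal :=
  ∫⁻ x, chainDensity n ℓ x * ENNReal.ofReal (Real.exp (c * x (Fin.last ℓ))) ∂orthantMeasure ℓ

theorem chain_zero (n : ℕ) {c : ℝ} (hc : c ∈ Set.Icc (0 : ℝ) 1) :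
    chain n 0 c = ENNReal.ofReal (transferPow (n + 1) 1 c) := by
  have hmp := measurePreserving_funUnique ((volume : Measure ℝ).restrict (Set.Ioi 0)) (Fin 1)
  have h1 : chain n 0 c = ∫⁻ s in Set.Ioi 0, ENNReal.ofReal (1 / n.factorial) *
      ENNReal.ofReal (s ^ n * (weight s * Real.exp (c * s))) := by
    rw [← hmp.lintegral_comp (by fun_prop), chain, orthantMeasure]
    refine lintegral_congr_ae ?_
    filter_upwards [ae_orthantMeasure_pos 0] with x hx
    have := (hx 0).le
    have := weight_nonneg this
    simp only [chainDensity, Finset.univ_eq_empty, Finset.prod_empty, mul_one]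
    rw [← ENNReal.ofReal_mul (by positivity), ← ENNReal.ofReal_mul (by positivity)]
    congr 1
    simp only [MeasurableEquiv.funUnique_apply, Fin.default_eq_zero, Fin.last_zero]
    ring
  rw [h1, lintegral_const_mul _ (by fun_prop), lintegral_pow_mul_weight_mul_exp n hc.2,
    ← ENNReal.tsum_mul_left, transferPow_succ, transfer, ENNReal.ofReal_tsum_of_nonneg]
  · refine tsum_congr fun j => ?_
    rw [← ENNReal.ofReal_mul (by positivity)]
    congr 1
    rw [transferPow, Function.iterate_zero, id]
    field_simp
  · exact fun j => mul_nonneg (by positivity)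
      ((incrementBound_transferPow _ 0).mem_Icc _ (branch_mem_Icc j hc)).1
  · exact (incrementBound_transferPow _ 0).summable hc

theorem chain_succ_eq (n ℓ : ℕ) (c : ℝ) : chain n (ℓ + 1) c = ∫⁻ x, chainDensity n ℓ x *
    (∫⁻ s in Set.Ioi 0, kernel (x (Fin.last ℓ)) s *
      ENNReal.ofReal (weight s * Real.exp (c * s))) ∂orthantMeasure ℓ := by
  have hmp := (measurePreserving_piFinSuccAbove
    (fun _ : Fin (ℓ + 2) => (volume : Measure ℝ).restrict (Set.Ioi 0)) (Fin.last (ℓ + 1))).symm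
  rw [chain, orthantMeasure, ← hmp.lintegral_comp (by fun_prop),
    lintegral_prod_symm' _ (by fun_prop)]
  refine lintegral_congr fun x => ?_
  rw [← lintegral_const_mul _ (by fun_prop)]
  refine setLIntegral_congr_fun measurableSet_Ioi fun s hs => ?_
  have e : (MeasurableEquiv.piFinSuccAbove (fun _ : Fin (ℓ + 2) => ℝ)
      (Fin.last (ℓ + 1))).symm (s, x) = Fin.snoc x s := by
    simp [MeasurableEquiv.piFinSuccAbove_symm_apply, Fin.insertNthEquiv, Fin.insertNth_last']
  have e0 : (Fin.snoc x s : Fin (ℓ + 2) → ℝ) 0 = x 0 := by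
    rw [← Fin.castSucc_zero]
    exact Fin.snoc_castSucc (α := fun _ => ℝ) _ _ _
  have ec : ∀ i : Fin (ℓ + 1), (Fin.snoc x s : Fin (ℓ + 2) → ℝ) i.castSucc = x i := fun i =>
    Fin.snoc_castSucc (α := fun _ => ℝ) _ _ _
  have el : (Fin.snoc x s : Fin (ℓ + 2) → ℝ) (Fin.last (ℓ + 1)) = s :=
    Fin.snoc_last (α := fun _ => ℝ) _ _
  simp only [e, chainDensity]
  rw [Fin.prod_univ_castSucc, e0, el, Fin.succ_last, ec, el,
    ENNReal.ofReal_mul (weight_nonneg (le_of_lt hs))]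
  simp_rw [Fin.succ_castSucc, ec]
  ring

theorem chain_succ_add (n ℓ : ℕ) {c : ℝ} (hc : c ≤ 1) :
    chain n (ℓ + 1) c + chain n ℓ 0 =
      ∑' j : ℕ, ENNReal.ofReal ((1 / 2) ^ (j + 1)) * chain n ℓ (branch j c) := by
  have h0 : chain n ℓ 0 = ∫⁻ x, chainDensity n ℓ x * 1 ∂orthantMeasure ℓ := by
    simp [chain]
  rw [chain_succ_eq, h0, ← lintegral_add_right _ (by fun_prop)]
  have hj : ∀ j : ℕ, ENNReal.ofReal ((1 / 2) ^ (j + 1)) * chain n ℓ (branch j c) =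
      ∫⁻ x, ENNReal.ofReal ((1 / 2) ^ (j + 1)) * (chainDensity n ℓ x *
        ENNReal.ofReal (Real.exp (branch j c * x (Fin.last ℓ)))) ∂orthantMeasure ℓ := fun j => by
    rw [chain, lintegral_const_mul _ (by fun_prop)]
  simp_rw [hj, ← mul_add]
  rw [← lintegral_tsum fun j => by fun_prop]
  refine lintegral_congr_ae ?_
  filter_upwards [ae_orthantMeasure_pos ℓ] with x hx
  rw [lintegral_kernel_add_one (hx _).le hc, ← ENNReal.tsum_mul_left]
  exact tsum_congr fun j => mul_left_comm _ _ _

/-- The iterated integrals are the increments of the iterates of the transfer operator. -/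
theorem chain_add_transferPow (n ℓ : ℕ) : ∀ c ∈ Set.Icc (0 : ℝ) 1,
    chain n ℓ c + ENNReal.ofReal (transferPow (n + 1) ℓ 0) =
      ENNReal.ofReal (transferPow (n + 1) (ℓ + 1) c) := by
  have h0 : (0 : ℝ) ∈ Set.Icc (0 : ℝ) 1 := ⟨le_rfl, zero_le_one⟩
  induction ℓ with
  | zero =>
    intro c hc
    rw [chain_zero n hc]
    simp [transferPow]
  | succ ℓ ih =>
    intro c hc
    have hb := incrementBound_transferPow (n + 1) (ℓ + 1)
    rw [← ih 0 h0, ← add_assoc, chain_succ_add n ℓ hc.2, transferPow_succ (n + 1) (ℓ + 1), transfer,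
      ENNReal.ofReal_tsum_of_nonneg
        (fun j => mul_nonneg (by positivity) (hb.mem_Icc _ (branch_mem_Icc j hc)).1)
        (hb.summable hc)]
    conv_lhs => rw [← one_mul (ENNReal.ofReal (transferPow (n + 1) ℓ 0)), ← tsum_ofReal_half_pow_succ,
      ← ENNReal.tsum_mul_right, ← ENNReal.tsum_add]
    refine tsum_congr fun j => ?_
    rw [← mul_add, ih _ (branch_mem_Icc j hc), ← ENNReal.ofReal_mul (by positivity)]

theorem chain_at_zero (n ℓ : ℕ) : chain n ℓ 0 =
    ENNReal.ofReal (transferPow (n + 1) (ℓ + 1) 0 - transferPow (n + 1) ℓ 0) := by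
  have h0 : (0 : ℝ) ∈ Set.Icc (0 : ℝ) 1 := ⟨le_rfl, zero_le_one⟩
  rw [ENNReal.ofReal_sub _ ((incrementBound_transferPow _ _).mem_Icc 0 h0).1,
    ← chain_add_transferPow n ℓ 0 h0, ENNReal.add_sub_cancel_right ENNReal.ofReal_ne_top]

/-! ### The multiple integrals -/

@[fun_prop]
theorem measurable_integrand (L ℓ : ℕ) : Measurable (integrand L ℓ) := by
  unfold integrand
  fun_prop

theorem integrand_nonneg (L ℓ : ℕ) {x : Fin (ℓ + 1) → ℝ} (hx : ∀ i, 0 < x i) :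
    0 ≤ integrand L ℓ x := by
  have h0 := hx 0
  refine mul_nonneg (by positivity) (div_nonneg (mul_nonneg ?_ ?_) ?_)
  · exact Real.rpow_nonneg (mul_nonneg (hx _).le (hx _).le) _
  · exact Finset.prod_nonneg fun i _ => besselI₁_nonneg (by positivity)
  · exact Finset.prod_nonneg fun i _ => inv_nonneg.1 (weight_nonneg (hx i).le)

/-- The square roots telescope along the chain. -/
theorem prod_sqrt_div_sqrt {ℓ : ℕ} {x : Fin (ℓ + 1) → ℝ} (hx : ∀ i, 0 < x i) :
    ∏ i : Fin ℓ, (√(x i.castSucc) / √(x i.succ)) = √(x 0) / √(x (Fin.last ℓ)) := by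
  have h := (Fin.prod_univ_castSucc fun i => √(x i)).symm.trans (Fin.prod_univ_succ fun i => √(x i))
  have hpos : ∀ i, √(x i) ≠ 0 := fun i => (Real.sqrt_pos.2 (hx i)).ne'
  rw [Finset.prod_div_distrib, div_eq_div_iff (Finset.prod_ne_zero_iff.2 fun i _ => hpos _)
    (hpos _), h]

theorem ofReal_integrand (n ℓ : ℕ) {x : Fin (ℓ + 1) → ℝ} (hx : ∀ i, 0 < x i) :
    ENNReal.ofReal (integrand (n + 1) ℓ x) = ENNReal.ofReal n.factorial * chainDensity n ℓ x := by
  have h0 := hx 0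
  have hw := fun i => weight_nonneg (hx i).le
  have hw0 := hw 0
  have hb : ∀ i : Fin ℓ, 0 ≤ besselI₁ (2 * √(x i.castSucc * x i.succ)) := fun i =>
    besselI₁_nonneg (by positivity)
  have hrpow : x 0 ^ (n + 1) * (x 0 * x (Fin.last ℓ)) ^ (-(1 / 2) : ℝ) =
      x 0 ^ n * (√(x 0) / √(x (Fin.last ℓ))) := by
    have hl := hx (Fin.last ℓ)
    have h1 : √(x 0) ≠ 0 := (Real.sqrt_pos.2 h0).ne'
    have h2 : √(x (Fin.last ℓ)) ≠ 0 := (Real.sqrt_pos.2 hl).ne'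
    rw [Real.rpow_neg (by positivity), ← Real.sqrt_eq_rpow, Real.sqrt_mul h0.le, pow_succ]
    nth_rewrite 2 [← Real.mul_self_sqrt h0.le]
    field_simp
  have hprod : ∏ i : Fin ℓ, (kernel (x i.castSucc) (x i.succ) *
      ENNReal.ofReal (weight (x i.succ))) = ENNReal.ofReal (∏ i : Fin ℓ,
        (√(x i.castSucc) / √(x i.succ) * besselI₁ (2 * √(x i.castSucc * x i.succ)) *
          weight (x i.succ))) := by
    rw [ENNReal.ofReal_prod_of_nonneg fun i _ =>
      mul_nonneg (mul_nonneg (by positivity) (hb i)) (hw _)]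
    refine Finset.prod_congr rfl fun i _ => ?_
    rw [kernel_eq_besselI₁ (hx _) (hx _),
      ← ENNReal.ofReal_mul (mul_nonneg (by positivity) (hb i))]
  rw [chainDensity, hprod, ← ENNReal.ofReal_mul (by positivity),
    ← ENNReal.ofReal_mul (by positivity)]
  congr 1
  have hden : (∏ i : Fin (ℓ + 1), (Real.exp (x i) * (2 * Real.exp (x i) - 1)))⁻¹ =
      weight (x 0) * ∏ i : Fin ℓ, weight (x i.succ) := by
    rw [← Finset.prod_inv_distrib, Fin.prod_univ_succ]
    rfl
  rw [integrand, div_eq_mul_inv, hden, Finset.prod_mul_distrib, Finset.prod_mul_distrib,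
    prod_sqrt_div_sqrt hx, ← mul_assoc (x 0 ^ (n + 1)), ← mul_assoc (x 0 ^ (n + 1)), hrpow]
  have : (n.factorial : ℝ) ≠ 0 := by positivity
  field_simp

theorem lintegral_integrand (n ℓ : ℕ) :
    ∫⁻ x in orthant ℓ, ENNReal.ofReal (integrand (n + 1) ℓ x) = ENNReal.ofReal
      (n.factorial * (transferPow (n + 1) (ℓ + 1) 0 - transferPow (n + 1) ℓ 0)) := by
  rw [volume_restrict_orthant, ENNReal.ofReal_mul (by positivity), ← chain_at_zero, chain,
    ← lintegral_const_mul _ (by fun_prop)]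
  refine lintegral_congr_ae ?_
  filter_upwards [ae_orthantMeasure_pos ℓ] with x hx
  rw [ofReal_integrand n ℓ hx]
  simp

theorem ae_integrand_nonneg (L ℓ : ℕ) : 0 ≤ᵐ[volume.restrict (orthant ℓ)] integrand L ℓ := by
  rw [volume_restrict_orthant]
  filter_upwards [ae_orthantMeasure_pos ℓ] with x hx using integrand_nonneg L ℓ hx

theorem integrableOn_integrand (n ℓ : ℕ) :
    IntegrableOn (integrand (n + 1) ℓ) (orthant ℓ) volume := by
  refine (lintegral_ofReal_ne_top_iff_integrable (measurable_integrand _ _).aestronglyMeasurable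
    (ae_integrand_nonneg _ _)).1 ?_
  rw [lintegral_integrand]
  exact ENNReal.ofReal_ne_top

theorem multiIntegral_eq (n ℓ : ℕ) : multiIntegral (n + 1) ℓ =
    n.factorial * (transferPow (n + 1) (ℓ + 1) 0 - transferPow (n + 1) ℓ 0) := by
  rw [multiIntegral, integral_eq_lintegral_of_nonneg_ae (ae_integrand_nonneg _ _)
    (measurable_integrand _ _).aestronglyMeasurable, lintegral_integrand, ENNReal.toReal_ofReal]
  exact mul_nonneg (by positivity) (sub_nonneg.2 (transferPow_zero_le_succ _ _).1)

theorem hasSum_multiIntegral (n : ℕ) :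
    HasSum (fun ℓ => multiIntegral (n + 1) ℓ) (n.factorial * moment (n + 1)) := by
  simp_rw [multiIntegral_eq]
  refine HasSum.mul_left _ ?_
  rw [hasSum_iff_tendsto_nat_of_nonneg fun ℓ => sub_nonneg.2 (transferPow_zero_le_succ _ _).1]
  have hsum : ∀ N, ∑ ℓ ∈ Finset.range N, (transferPow (n + 1) (ℓ + 1) 0 - transferPow (n + 1) ℓ 0) =
      transferPow (n + 1) N 0 - transferPow (n + 1) 0 0 :=
    Finset.sum_range_sub fun ℓ => transferPow (n + 1) ℓ 0
  have h0 : transferPow (n + 1) 0 0 = 0 := by simp [transferPow]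
  simpa [hsum, h0] using tendsto_transferPow_zero (n + 1)

end QuestionMark

theorem mainTheorem1 :
    (∀ L : ℕ, 1 ≤ L →
      (∀ ℓ : ℕ, IntegrableOn (QuestionMark.integrand L ℓ) (QuestionMark.orthant ℓ) volume) ∧
      Summable (fun ℓ : ℕ => QuestionMark.multiIntegral L ℓ) ∧
      QuestionMark.moment L =
        1 / ((L - 1).factorial : ℝ) * ∑' ℓ : ℕ, QuestionMark.multiIntegral L ℓ) ∧
    ∃ C : ℝ, ∀ L : ℕ, 1 ≤ L → ∀ ℓ : ℕ,
      |1 / ((L - 1).factorial : ℝ) * QuestionMark.multiIntegral L ℓ| ≤ C / 2 ^ ℓ := by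
  refine ⟨fun L hL => ?_, 1, fun L hL ℓ => ?_⟩ <;>
    obtain ⟨n, rfl⟩ := Nat.exists_eq_add_of_le' hL <;>
    have hn : (n.factorial : ℝ) ≠ 0 := by positivity
  · have h := QuestionMark.hasSum_multiIntegral n
    refine ⟨QuestionMark.integrableOn_integrand n, h.summable, ?_⟩
    rw [h.tsum_eq, Nat.add_sub_cancel]
    field_simp
  · obtain ⟨h1, h2⟩ := QuestionMark.transferPow_zero_le_succ (n + 1) ℓ
    rw [QuestionMark.multiIntegral_eq, Nat.add_sub_cancel, one_div, inv_mul_cancel_left₀ hn,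
      abs_of_nonneg (sub_nonneg.2 h1), ← one_div_pow]
    exact h2
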